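/- For $x:[0,\infty)\to\mathbb{R}$, $c>0$ and $0\le s\le t<\infty$ let the truncated variation of $x$ on $[s,t]$ be $$\mathrm{TV}^{c}(x,[s,t])=\sup\sum_{i=1}^{n}\max\{|x_{u_i}-x_{u_{i-1}}|-c,\,0\},$$ where the supremum is over all $n$ and all partitions $s=u_0\le u_1\le\dots\le u_n=t$. Let $(\Omega,\mathcal F,\mathbb P)$ be a probability space and let $X=(X_t)_{t\ge 0}$ be a real process on it with càdlàg trajectories such that * $X$ is self-similar with index $\beta>0$: for every $A>0$ the processes $(A^{-\beta}X_{At})_{t\ge0}$ and $(X_t)_{t\ge0}$ have the same distribution; * $X$ has stationary increments: for all $0\le t_1<t_2<\dots<t_n$ and $h>0$ the vectors $(X_{t_{i+1}}-X_{t_i})_{1\le i<n}$ and $(X_{t_{i+1}+h}-X_{t_i+h})_{1\le i<n}$ have the same distribution; * $X$ is not the zero process, i.e. $\mathbb P(X_t\ne 0)>0$ for some $t\ge0$. Assume that $\mathbb E\,\mathrm{TV}^{c_0}(X,[0,1])<\infty$ for some $c_0>0$, and that for every integer $k\ge1$ the (stationary) sequence $\big(\mathrm{TV}^{1}(X,[jk,(j+1)k])\big)_{j=0,1,2,\dots}$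 is ergodic. Then there exists a constant $C\in(0,\infty)$ such that for every $t\ge 0$ $$c^{1/\beta-1}\,\mathrm{TV}^{c}(X,[0,t])\longrightarrow C\,t\quad\text{in probability as } c\to0+ .$$ -/

import Mathlib

open MeasureTheory ProbabilityTheory Filter Set
open scoped NNReal ENNReal Topology

noncomputable section

/-- The truncated variation `TV^c(x, [s, t])` of a path `x : [0, ∞) → ℝ`, as an element of `[0, ∞]`:
the supremum, over all finite partitions `s = u 0 ≤ u 1 ≤ ⋯ ≤ u n = t` of `[s, t]`, of
`∑ (|x (u (i + 1)) - x (u i)| - c)₊`. It is meant for `0 ≤ c` and `s ≤ t`; degenerate intervals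
contribute `0`, and the value for `s = t` is `0`.
(`ENNReal.ofReal a` is the positive part of the real number `a`.) -/
def truncVar (x : ℝ≥0 → ℝ) (c : ℝ) (s t : ℝ≥0) : ℝ≥0∞ :=
  ⨆ p : {p : ℕ × (ℕ → ℝ≥0) // Monotone p.2 ∧ p.2 0 = s ∧ p.2 p.1 = t},
    ∑ i ∈ Finset.range p.1.1, ENNReal.ofReal (|x (p.1.2 (i + 1)) - x (p.1.2 i)| - c)

/-- A càdlàg path on `[0, ∞)`: right-continuous, with left limits in `ℝ`
(the condition on left limits is void at time `0`). -/
def IsCadlag (x : ℝ≥0 → ℝ) : Prop :=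
  ∀ t : ℝ≥0, ContinuousWithinAt x (Ioi t) t ∧ ∃ l : ℝ, Tendsto x (𝓝[<] t) (𝓝 l)

variable {Ω : Type*} [MeasurableSpace Ω]

/-- `X` is self-similar with index `β`: for every `A > 0` the processes `A^{-β} X_{A t}` and `X_t`,
`t ≥ 0`, have the same distribution, as random elements of `ℝ^[0, ∞)` with the product σ-algebra
(equivalently, the same finite-dimensional distributions). -/
def IsSelfSimilar (X : ℝ≥0 → Ω → ℝ) (β : ℝ) (P : Measure Ω) : Prop :=
  ∀ A : ℝ≥0, 0 < A →
    IdentDistrib (fun ω (t : ℝ≥0) => (A : ℝ) ^ (-β) * X (A * t) ω)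
      (fun ω (t : ℝ≥0) => X t ω) P P

/-- `X` has stationary increments: the joint law of the increments of `X` along
`t 0 < t 1 < ⋯ < t n` does not change when all times are shifted by `h > 0`. -/
def HasStationaryIncrements (X : ℝ≥0 → Ω → ℝ) (P : Measure Ω) : Prop :=
  ∀ (n : ℕ) (t : Fin (n + 1) → ℝ≥0), StrictMono t → ∀ h : ℝ≥0, 0 < h →
    IdentDistrib (fun ω (i : Fin n) => X (t i.succ) ω - X (t i.castSucc) ω)
      (fun ω (i : Fin n) => X (t i.succ + h) ω - X (t i.castSucc + h) ω) P P

/-- Ergodicity of a (stationary) sequence `Y` of random variables: every shift-invariant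
measurable set of sequences has probability `0` or `1` under the law of `Y`. Stationarity itself is
not part of this property. -/
def IsErgodicSeq {E : Type*} [MeasurableSpace E] (Y : ℕ → Ω → E) (P : Measure Ω) : Prop :=
  PreErgodic (fun (y : ℕ → E) (j : ℕ) => y (j + 1)) (P.map (fun ω (j : ℕ) => Y j ω))

end

/-! Put `A = c ^ (-1/β)`. Self-similarity gives `TV^c(X,[0,t])` the law of `c * TV^1(X,[0,A t])`, so
the normalised variable has the law of `A⁻¹ * TV^1(X,[0,A t])` (`identDistrib_truncVar_scale`).
Since the limit is a constant, convergence in probability depends only on these laws, and what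
remains is a weak law of large numbers: `TV^1(X,[0,T]) / T → C` in probability as `T → ∞`
(`exists_tendsto_measure_truncVar`).

`TV^1` is superadditive over adjacent intervals, and each cut loses at most `1` (`truncVar_add_le`,
`truncVar_le_add_add`). Cut `[0,T]` into blocks of length `k`: the error is at most `1` per block,
hence about `1/k` per unit of time. The block variables are stationary and ergodic, so by the mean
ergodic theorem their averages tend to `a k = E TV^1(X,[0,k])`
(`tendstoInMeasure_average_of_ergodic`). Taking expectations in the two inequalities places `a k`
within `1` of `C * k` for a single slope `C` (`exists_slope`). Fixing `k` large and then letting `T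
→ ∞` gives the law of large numbers.

If `C ≤ 0`, then `TV^1` vanishes almost surely on every `[0,k]`; by scaling so does `TV^c` for
arbitrarily small `c`, which forces `X` to be the zero process (`eq_zero_of_truncVar_eq_zero`). -/

/-! ### Pathwise properties of the truncated variation. -/

theorem sum_le_truncVar (x : ℝ≥0 → ℝ) (c : ℝ) {n : ℕ} {u : ℕ → ℝ≥0} (hu : Monotone u) :
    ∑ i ∈ Finset.range n, ENNReal.ofReal (|x (u (i + 1)) - x (u i)| - c) ≤
      truncVar x c (u 0) (u n) :=
  le_iSup_of_le (⟨(n, u), hu, rfl, rfl⟩ :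
    {p : ℕ × (ℕ → ℝ≥0) // Monotone p.2 ∧ p.2 0 = u 0 ∧ p.2 p.1 = u n}) le_rfl

theorem truncVar_le {x : ℝ≥0 → ℝ} {c : ℝ} {s t : ℝ≥0} {b : ℝ≥0∞}
    (h : ∀ (n : ℕ) (u : ℕ → ℝ≥0), Monotone u → u 0 = s → u n = t →
      ∑ i ∈ Finset.range n, ENNReal.ofReal (|x (u (i + 1)) - x (u i)| - c) ≤ b) :
    truncVar x c s t ≤ b :=
  iSup_le fun p => h p.1.1 p.1.2 p.2.1 p.2.2.1 p.2.2.2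

theorem ofReal_abs_sub_le_truncVar (x : ℝ≥0 → ℝ) (c : ℝ) {s t : ℝ≥0} (hst : s ≤ t) :
    ENNReal.ofReal (|x t - x s| - c) ≤ truncVar x c s t := by
  have hu : Monotone fun i : ℕ => if i = 0 then s else t := by
    refine monotone_nat_of_le_succ fun i => ?_
    by_cases hi : i = 0 <;> simp [hi, hst]
  simpa using sum_le_truncVar x c (n := 1) hu

theorem truncVar_add_le (x : ℝ≥0 → ℝ) (c : ℝ) {r s t : ℝ≥0} (hrs : r ≤ s) (hst : s ≤ t) :
    truncVar x c r s + truncVar x c s t ≤ truncVar x c r t := by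
  have ne : ∀ {a b : ℝ≥0}, a ≤ b →
      Nonempty {p : ℕ × (ℕ → ℝ≥0) // Monotone p.2 ∧ p.2 0 = a ∧ p.2 p.1 = b} := by
    intro a b hab
    refine ⟨⟨(1, fun i => if i = 0 then a else b), ?_, by simp, by simp⟩⟩
    refine monotone_nat_of_le_succ fun i => ?_
    by_cases hi : i = 0 <;> simp [hi, hab]
  have := ne hrs
  have := ne hst
  refine ENNReal.iSup_add_iSup_le ?_
  rintro ⟨⟨n, u⟩, hu, hu0, hun⟩ ⟨⟨m, v⟩, hv, hv0, hvm⟩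
  simp only at hu hu0 hun hv hv0 hvm ⊢
  -- The concatenated partition; the two branches agree at `i = n`, where both equal `s`.
  set w : ℕ → ℝ≥0 := fun i => if i ≤ n then u i else v (i - n) with hw
  have hwr : ∀ i, w (n + i) = v i := by
    intro i
    rcases Nat.eq_zero_or_pos i with rfl | hi
    · simp [hw, hun, hv0]
    · have : ¬ n + i ≤ n := by lia
      simp [hw, hi.ne']
  have hwl : ∀ i, i ≤ n → w i = u i := fun i hi => by simp [hw, hi]
  have hwm : Monotone w := by
    refine monotone_nat_of_le_succ fun i => ?_
    rcases lt_or_ge i n with hi | hi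
    · rw [hwl i hi.le, hwl (i + 1) hi]
      exact hu (Nat.le_succ i)
    · obtain ⟨j, rfl⟩ := Nat.exists_eq_add_of_le hi
      rw [hwr, add_assoc, hwr]
      exact hv (Nat.le_succ j)
  have key := sum_le_truncVar x c (n := n + m) hwm
  rw [hwr, hwl 0 (Nat.zero_le n), hu0, hvm, Finset.sum_range_add] at key
  refine le_trans (le_of_eq ?_) key
  congr 1
  · refine Finset.sum_congr rfl fun i hi => ?_
    have hi := Finset.mem_range.1 hi
    rw [hwl i hi.le, hwl (i + 1) hi]
  · refine Finset.sum_congr rfl fun i _ => ?_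
    rw [add_assoc, hwr, hwr]

theorem truncVar_mono_right (x : ℝ≥0 → ℝ) (c : ℝ) {r s t : ℝ≥0} (hrs : r ≤ s) (hst : s ≤ t) :
    truncVar x c r s ≤ truncVar x c r t :=
  le_self_add.trans (truncVar_add_le x c hrs hst)

theorem ofReal_abs_sub_sub_le (a b d c : ℝ) :
    ENNReal.ofReal (|d - a| - c) ≤
      ENNReal.ofReal (|b - a| - c) + ENNReal.ofReal (|d - b| - c) + ENNReal.ofReal c := by
  have h1 : |d - a| ≤ |b - a| + |d - b| := by
    rw [add_comm]; exact abs_sub_le d b a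
  calc ENNReal.ofReal (|d - a| - c)
      ≤ ENNReal.ofReal ((|b - a| - c) + (|d - b| - c) + c) :=
        ENNReal.ofReal_le_ofReal (by linarith)
    _ ≤ ENNReal.ofReal ((|b - a| - c) + (|d - b| - c)) + ENNReal.ofReal c :=
        ENNReal.ofReal_add_le
    _ ≤ _ := by gcongr; exact ENNReal.ofReal_add_le

/-- Capping a partition at `s` from above and from below splits it into partitions of the two
halves. Only one step can straddle `s`, and splitting that step subtracts `c` twice instead of once.
-/
theorem truncVar_le_add_add (x : ℝ≥0 → ℝ) {c : ℝ} (hc : 0 ≤ c) {r s t : ℝ≥0} (hrs : r ≤ s)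
    (hst : s ≤ t) :
    truncVar x c r t ≤ truncVar x c r s + truncVar x c s t + ENNReal.ofReal c := by
  refine truncVar_le fun n u hu hu0 hun => ?_
  have hl : Monotone fun i => min (u i) s := fun i j h => min_le_min_right s (hu h)
  have hr : Monotone fun i => max (u i) s := fun i j h => max_le_max_right s (hu h)
  have h1 := sum_le_truncVar x c (n := n) hl
  have h2 := sum_le_truncVar x c (n := n) hr
  simp only [hu0, hun, min_eq_left hrs, min_eq_right hst, max_eq_right hrs, max_eq_left hst]
    at h1 h2
  refine le_trans ?_ (add_le_add_left (add_le_add h1 h2) _)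
  -- The indicator records whether `s` has already been crossed, so that the induction pays the
  -- penalty `c` only once.
  have key : ∀ m, ∑ i ∈ Finset.range m, ENNReal.ofReal (|x (u (i + 1)) - x (u i)| - c) ≤
      ∑ i ∈ Finset.range m,
          ENNReal.ofReal (|x (min (u (i + 1)) s) - x (min (u i) s)| - c) +
        ∑ i ∈ Finset.range m,
          ENNReal.ofReal (|x (max (u (i + 1)) s) - x (max (u i) s)| - c) +
        if s < u m then ENNReal.ofReal c else 0 := by
    intro m
    induction m with
    | zero => simp
    | succ m ih =>
      rw [Finset.sum_range_succ, Finset.sum_range_succ, Finset.sum_range_succ]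
      set S := ∑ i ∈ Finset.range m,
          ENNReal.ofReal (|x (min (u (i + 1)) s) - x (min (u i) s)| - c)
      set T := ∑ i ∈ Finset.range m,
          ENNReal.ofReal (|x (max (u (i + 1)) s) - x (max (u i) s)| - c)
      have hm : u m ≤ u (m + 1) := hu (Nat.le_succ m)
      have hz : ENNReal.ofReal (|x s - x s| - c) = 0 := by simp [hc]
      rcases le_or_gt (u (m + 1)) s with h | h
      · have h' := hm.trans h
        rw [if_neg (not_lt.2 h')] at ih
        rw [if_neg (not_lt.2 h), min_eq_left h, min_eq_left h', max_eq_right h, max_eq_right h',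
          hz]
        calc _ ≤ (S + T + 0) + ENNReal.ofReal (|x (u (m + 1)) - x (u m)| - c) := by gcongr
          _ = _ := by ring
      · rw [if_pos h, min_eq_right h.le, max_eq_left h.le]
        rcases lt_or_ge s (u m) with h' | h'
        · rw [if_pos h'] at ih
          rw [min_eq_right h'.le, max_eq_left h'.le, hz]
          calc _ ≤ (S + T + ENNReal.ofReal c) + ENNReal.ofReal (|x (u (m + 1)) - x (u m)| - c) := by
                gcongr
            _ = _ := by ring
        · rw [if_neg (not_lt.2 h')] at ih
          rw [min_eq_left h', max_eq_right h']
          calc _ ≤ (S + T + 0) + (ENNReal.ofReal (|x s - x (u m)| - c) +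
                ENNReal.ofReal (|x (u (m + 1)) - x s| - c) + ENNReal.ofReal c) :=
                add_le_add ih (ofReal_abs_sub_sub_le _ _ _ _)
            _ = _ := by ring
  refine (key n).trans ?_
  gcongr
  split_ifs <;> simp

theorem truncVar_self (x : ℝ≥0 → ℝ) {c : ℝ} (hc : 0 ≤ c) (s : ℝ≥0) : truncVar x c s s = 0 := by
  refine le_antisymm (truncVar_le fun n u hu hu0 hun => ?_) zero_le
  refine (Finset.sum_eq_zero fun i hi => ?_).le
  have hi := Finset.mem_range.1 hi
  have h : ∀ j, j ≤ n → u j = s := fun j hj =>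
    le_antisymm (hun ▸ hu hj) (hu0 ▸ hu (Nat.zero_le j))
  rw [h i hi.le, h (i + 1) hi]
  simp [hc]

theorem sum_truncVar_le (x : ℝ≥0 → ℝ) (c : ℝ) {τ : ℕ → ℝ≥0} (hτ : Monotone τ) (n : ℕ) :
    ∑ j ∈ Finset.range n, truncVar x c (τ j) (τ (j + 1)) ≤ truncVar x c (τ 0) (τ n) := by
  induction n with
  | zero => simp
  | succ n ih =>
    rw [Finset.sum_range_succ]
    exact (add_le_add_left ih _).trans
      (truncVar_add_le x c (hτ (Nat.zero_le n)) (hτ (Nat.le_succ n)))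

theorem truncVar_le_sum (x : ℝ≥0 → ℝ) {c : ℝ} (hc : 0 ≤ c) {τ : ℕ → ℝ≥0} (hτ : Monotone τ)
    (n : ℕ) :
    truncVar x c (τ 0) (τ n) ≤
      ∑ j ∈ Finset.range n, truncVar x c (τ j) (τ (j + 1)) + n * ENNReal.ofReal c := by
  induction n with
  | zero => simp [truncVar_self x hc]
  | succ n ih =>
    rw [Finset.sum_range_succ]
    refine (truncVar_le_add_add x hc (hτ (Nat.zero_le n)) (hτ (Nat.le_succ n))).trans ?_
    refine (add_le_add_left (add_le_add_left ih _) _).trans (le_of_eq ?_)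
    push_cast
    ring

/-- A monotone time change carries partitions to partitions. Applied to a time change and to its
inverse it yields equalities; the comparison is needed only on `[s, t]` because truncated
subtraction inverts a shift by `h` only from `h` on. -/
theorem truncVar_le_of_monotone {x y : ℝ≥0 → ℝ} (c : ℝ) {s t : ℝ≥0} {φ : ℝ≥0 → ℝ≥0}
    (hφ : Monotone φ)
    (h : ∀ q ∈ Icc s t, ∀ r ∈ Icc s t, |y r - y q| = |x (φ r) - x (φ q)|) :
    truncVar y c s t ≤ truncVar x c (φ s) (φ t) := by
  refine truncVar_le fun n u hu hu0 hun => ?_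
  have key := sum_le_truncVar x c (n := n) (hφ.comp hu)
  simp only [Function.comp_apply, hu0, hun] at key
  refine le_trans (le_of_eq (Finset.sum_congr rfl fun i hi => ?_)) key
  have hi := Finset.mem_range.1 hi
  have hI : ∀ j, j ≤ n → u j ∈ Icc s t := fun j hj =>
    ⟨hu0 ▸ hu (Nat.zero_le j), hun ▸ hu hj⟩
  rw [h _ (hI i hi.le) _ (hI (i + 1) hi)]

theorem truncVar_shift (x : ℝ≥0 → ℝ) (b c : ℝ) (s t h : ℝ≥0) :
    truncVar (fun r => x (r + h) - b) c s t = truncVar x c (s + h) (t + h) := by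
  refine le_antisymm ?_ ?_
  · exact truncVar_le_of_monotone c (φ := fun r => r + h) (fun _ _ hab => add_le_add_left hab h)
      fun q _ r _ => by ring_nf
  · have := truncVar_le_of_monotone (x := fun r => x (r + h) - b) (y := x) (s := s + h)
      (t := t + h) c (φ := fun r => r - h) (fun _ _ hab => tsub_le_tsub_right hab h) ?_
    · simpa using this
    · intro q hq r hr
      have hq' : h ≤ q := le_add_self.trans hq.1
      have hr' : h ≤ r := le_add_self.trans hr.1
      simp only [tsub_add_cancel_of_le hq', tsub_add_cancel_of_le hr']
      ring_nf

theorem truncVar_comp_mul (x : ℝ≥0 → ℝ) (c : ℝ) (s t : ℝ≥0) {A : ℝ≥0} (hA : A ≠ 0) :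
    truncVar (fun r => x (A * r)) c s t = truncVar x c (A * s) (A * t) := by
  refine le_antisymm ?_ ?_
  · exact truncVar_le_of_monotone c (φ := fun r => A * r) (fun _ _ hab => mul_le_mul_right hab A)
      fun q _ r _ => rfl
  · have := truncVar_le_of_monotone (x := fun r => x (A * r)) (y := x) (s := A * s)
      (t := A * t) c (φ := fun r => A⁻¹ * r) (fun _ _ hab => mul_le_mul_right hab A⁻¹) ?_
    · simpa [← mul_assoc, inv_mul_cancel₀ hA] using this
    · intro q hq r hr
      simp [← mul_assoc, mul_inv_cancel₀ hA]

theorem truncVar_const_mul (x : ℝ≥0 → ℝ) {a : ℝ} (ha : 0 ≤ a) (c : ℝ) (s t : ℝ≥0) :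
    truncVar (fun r => a * x r) (a * c) s t = ENNReal.ofReal a * truncVar x c s t := by
  unfold truncVar
  rw [ENNReal.mul_iSup]
  refine iSup_congr fun p => ?_
  rw [Finset.mul_sum]
  refine Finset.sum_congr rfl fun i _ => ?_
  rw [← ENNReal.ofReal_mul ha, ← mul_sub, abs_mul, abs_of_nonneg ha, mul_sub]

/-! ### Reduction to countably many partitions, for measurability. -/

/-- The truncated variation of `x` on `[s, t]`, computed along partitions with points in `D`. -/
noncomputable def truncVarOn (D : Set ℝ≥0) (c : ℝ) (s t : ℝ≥0) (x : ℝ≥0 → ℝ) : ℝ≥0∞ :=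
  ⨆ (n : ℕ) (v : Fin (n + 1) → D)
    (_ : Monotone v ∧ (v 0 : ℝ≥0) = s ∧ (v (Fin.last n) : ℝ≥0) = t),
    ∑ i : Fin n, ENNReal.ofReal (|x (v i.succ) - x (v i.castSucc)| - c)

/-- Indexing partitions by finite tuples makes the supremum countable when `D` is; infinite
sequences in `D` would not be countable. -/
theorem measurable_truncVarOn {D : Set ℝ≥0} (hD : D.Countable) (c : ℝ) (s t : ℝ≥0) :
    Measurable (truncVarOn D c s t) := by
  have := hD.to_subtype
  unfold truncVarOn
  refine Measurable.iSup fun n => Measurable.iSup fun v => Measurable.iSup_Prop _ ?_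
  refine Finset.measurable_sum _ fun i _ => ENNReal.measurable_ofReal.comp ?_
  have h : Measurable fun x : ℝ≥0 → ℝ => x (v i.succ) - x (v i.castSucc) :=
    (measurable_pi_apply _).sub (measurable_pi_apply _)
  exact (continuous_abs.measurable.comp h).sub_const c

theorem truncVarOn_le_truncVar (D : Set ℝ≥0) (c : ℝ) (s t : ℝ≥0) (x : ℝ≥0 → ℝ) :
    truncVarOn D c s t x ≤ truncVar x c s t := by
  refine iSup_le fun n => iSup_le fun v => iSup_le fun ⟨hv, h0, hn⟩ => ?_
  have hu : Monotone fun i : ℕ => (v ⟨min i n, by lia⟩ : ℝ≥0) := fun i j hij =>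
    hv (Fin.mk_le_mk.2 (min_le_min_right n hij))
  have key := sum_le_truncVar x c (n := n) hu
  have e0 : (⟨min 0 n, by lia⟩ : Fin (n + 1)) = 0 := by ext; simp
  have en : (⟨min n n, by lia⟩ : Fin (n + 1)) = Fin.last n := by ext; simp
  rw [e0, en, h0, hn] at key
  refine le_trans (le_of_eq ?_) key
  rw [← Fin.sum_univ_eq_sum_range
    (fun i => ENNReal.ofReal (|x (v ⟨min (i + 1) n, by lia⟩) - x (v ⟨min i n, by lia⟩)| - c))]
  refine Finset.sum_congr rfl fun i _ => ?_
  have e1 : (⟨min (i + 1) n, by lia⟩ : Fin (n + 1)) = i.succ := by ext; simp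
  have e2 : (⟨min i n, by lia⟩ : Fin (n + 1)) = i.castSucc := by ext; simp
  rw [e1, e2]

/-- The set of nonnegative rationals, enlarged by `s` and `t`. -/
def ratPoints (s t : ℝ≥0) : Set ℝ≥0 :=
  insert s (insert t (range fun q : ℕ × ℕ => (q.1 : ℝ≥0) / q.2))

theorem countable_ratPoints (s t : ℝ≥0) : (ratPoints s t).Countable :=
  ((countable_range _).insert t).insert s

open Classical in
/-- Rounding up to the grid `ℕ / (m + 1)` inside `[s, t]`, keeping `s` fixed. -/
noncomputable def gridRound (s t : ℝ≥0) (m : ℕ) (v : ℝ≥0) : ℝ≥0 :=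
  if v = s then s else min t (⌈v * (m + 1)⌉₊ / ((m + 1 : ℕ) : ℝ≥0))

theorem gridRound_mem (s t : ℝ≥0) (m : ℕ) (v : ℝ≥0) : gridRound s t m v ∈ ratPoints s t := by
  unfold gridRound
  split_ifs
  · exact mem_insert _ _
  · rcases min_choice t (⌈v * (m + 1)⌉₊ / ((m + 1 : ℕ) : ℝ≥0)) with h | h <;> rw [h]
    · exact mem_insert_of_mem _ (mem_insert _ _)
    · exact mem_insert_of_mem _ (mem_insert_of_mem _
        ⟨(⌈v * (m + 1)⌉₊, m + 1), rfl⟩)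

theorem le_gridRound {s t v : ℝ≥0} (m : ℕ) (hv : v ≤ t) : v ≤ gridRound s t m v := by
  unfold gridRound
  split_ifs with h
  · exact h.le
  · refine le_min hv ?_
    rw [le_div_iff₀ (by positivity)]
    exact_mod_cast Nat.le_ceil (v * (m + 1))

theorem gridRound_le {s t : ℝ≥0} (m : ℕ) (v : ℝ≥0) :
    gridRound s t m v ≤ v + 1 / ((m : ℝ≥0) + 1) := by
  unfold gridRound
  split_ifs with h
  · exact h ▸ le_self_add
  · refine (min_le_right _ _).trans ?_
    rw [div_le_iff₀ (by positivity)]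
    push_cast
    rw [add_mul, one_div, inv_mul_cancel₀ (by positivity)]
    exact (Nat.ceil_lt_add_one zero_le).le

/-- The exceptional value at `s` does no harm on `[s, t]`: every later point is rounded upwards and
so stays above `s`. -/
theorem monotoneOn_gridRound (s t : ℝ≥0) (m : ℕ) : MonotoneOn (gridRound s t m) (Icc s t) := by
  intro v hv w hw hvw
  by_cases h : v = s
  · have : gridRound s t m v = v := by simp [gridRound, h]
    rw [this]
    exact hvw.trans (le_gridRound m hw.2)
  · have h' : w ≠ s := fun e => h (le_antisymm (e ▸ hvw) hv.1)
    rw [gridRound, gridRound, if_neg h, if_neg h']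
    gcongr

theorem tendsto_gridRound {s t v : ℝ≥0} (hv : v ≤ t) :
    Tendsto (fun m => gridRound s t m v) atTop (𝓝[≥] v) := by
  refine tendsto_nhdsWithin_iff.2 ⟨?_, Eventually.of_forall fun m => le_gridRound m hv⟩
  refine tendsto_of_tendsto_of_tendsto_of_le_of_le tendsto_const_nhds ?_
    (fun m => le_gridRound m hv) fun m => gridRound_le m v
  simpa using (tendsto_const_nhds (x := v)).add
    (tendsto_one_div_add_atTop_nhds_zero_nat (𝕜 := ℝ≥0))

/-- Rounding a partition up to ever finer grids moves its points in from the right, so by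
right-continuity the sums converge to the original sum. This makes the truncated variation a
measurable functional of the path, so equality in law of processes passes to it. -/
theorem truncVar_eq_truncVarOn {x : ℝ≥0 → ℝ} (hx : ∀ t, ContinuousWithinAt x (Ioi t) t)
    (c : ℝ) {s t : ℝ≥0} (hst : s ≤ t) :
    truncVar x c s t = truncVarOn (ratPoints s t) c s t x := by
  refine le_antisymm (truncVar_le fun n u hu hu0 hun => ?_) (truncVarOn_le_truncVar _ _ _ _ _)
  have hI : ∀ j, j ≤ n → u j ∈ Icc s t := fun j hj =>
    ⟨hu0 ▸ hu (Nat.zero_le j), hun ▸ hu hj⟩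
  have hlim : ∀ j, j ≤ n → Tendsto (fun m => x (gridRound s t m (u j))) atTop (𝓝 (x (u j))) :=
    fun j hj => (continuousWithinAt_Ioi_iff_Ici.1 (hx (u j))).tendsto.comp
      (tendsto_gridRound (hI j hj).2)
  have hsum : Tendsto (fun m => ∑ i ∈ Finset.range n, ENNReal.ofReal
      (|x (gridRound s t m (u (i + 1))) - x (gridRound s t m (u i))| - c)) atTop
      (𝓝 (∑ i ∈ Finset.range n, ENNReal.ofReal (|x (u (i + 1)) - x (u i)| - c))) := by
    refine tendsto_finsetSum _ fun i hi => ?_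
    have hi := Finset.mem_range.1 hi
    exact ENNReal.tendsto_ofReal ((((hlim _ hi).sub (hlim _ hi.le)).abs).sub_const c)
  refine le_of_tendsto' hsum fun m => ?_
  refine le_iSup_of_le n (le_iSup_of_le
    (fun i : Fin (n + 1) => ⟨gridRound s t m (u i), gridRound_mem s t m _⟩)
    (le_iSup_of_le ⟨?_, ?_, ?_⟩ ?_))
  · intro i j hij
    exact monotoneOn_gridRound s t m (hI i (by lia)) (hI j (by lia)) (hu hij)
  · simp [hu0, gridRound]
  · simp only [Fin.val_last, hun]
    exact le_antisymm (by unfold gridRound; split_ifs <;> simp [hst]) (le_gridRound m le_rfl)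
  · rw [← Fin.sum_univ_eq_sum_range (fun i => ENNReal.ofReal
      (|x (gridRound s t m (u (i + 1))) - x (gridRound s t m (u i))| - c))]
    simp

/-! ### The mean ergodic theorem, in `L²` and then in `L¹`. -/

section MeanErgodic

variable {α : Type*} [MeasurableSpace α] {μ : Measure α} {τ : α → α}

theorem memLp_birkhoffAverage {p : ℝ≥0∞} {f : α → ℝ} (hτ : MeasurePreserving τ μ μ)
    (hf : MemLp f p μ) (n : ℕ) : MemLp (birkhoffAverage ℝ τ f n) p μ := by
  have : birkhoffAverage ℝ τ f n = (n : ℝ)⁻¹ • ∑ k ∈ Finset.range n, f ∘ τ^[k] := by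
    ext x; simp [birkhoffAverage, birkhoffSum]
  rw [this]
  exact (memLp_finsetSum' _ fun k _ => hf.comp_measurePreserving (hτ.iterate k)).const_smul _

theorem eLpNorm_birkhoffAverage_le {f : α → ℝ} (hτ : MeasurePreserving τ μ μ)
    (hf : AEStronglyMeasurable f μ) (n : ℕ) :
    eLpNorm (birkhoffAverage ℝ τ f n) 1 μ ≤ eLpNorm f 1 μ := by
  have : birkhoffAverage ℝ τ f n = (n : ℝ)⁻¹ • ∑ k ∈ Finset.range n, f ∘ τ^[k] := by
    ext x; simp [birkhoffAverage, birkhoffSum]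
  rw [this, eLpNorm_const_smul]
  have h1 : eLpNorm (∑ k ∈ Finset.range n, f ∘ τ^[k]) 1 μ ≤ n * eLpNorm f 1 μ := by
    refine (eLpNorm_sum_le (fun k _ => hf.comp_measurePreserving (hτ.iterate k)) le_rfl).trans ?_
    simp [eLpNorm_comp_measurePreserving hf (hτ.iterate _)]
  refine (mul_le_mul_right h1 _).trans ?_
  rcases Nat.eq_zero_or_pos n with rfl | hn
  · simp
  · rw [← mul_assoc, enorm_inv (by positivity), Real.enorm_natCast, ENNReal.inv_mul_cancel
      (by simpa using hn.ne') (by simp), one_mul]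

/-- Identifies pointwise Birkhoff averages with those of the Koopman isometry on `L²`, to which von
Neumann's theorem applies. -/
theorem toLp_birkhoffAverage {f : α → ℝ} (hτ : MeasurePreserving τ μ μ) (hf : MemLp f 2 μ)
    (n : ℕ) :
    (memLp_birkhoffAverage hτ hf n).toLp = birkhoffAverage ℝ
      (Lp.compMeasurePreservingₗᵢ ℝ (p := 2) (E := ℝ) τ hτ) id n hf.toLp := by
  have hit : ∀ k, (Lp.compMeasurePreservingₗᵢ ℝ (p := 2) (E := ℝ) τ hτ)^[k] hf.toLp =
      (hf.comp_measurePreserving (hτ.iterate k)).toLp := by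
    intro k
    induction k with
    | zero => rfl
    | succ k ih =>
      rw [Function.iterate_succ_apply', ih]
      exact Lp.toLp_compMeasurePreserving (hf.comp_measurePreserving (hτ.iterate k)) hτ
  simp only [birkhoffAverage, birkhoffSum, hit, id]
  refine Lp.ext ?_
  refine (MemLp.coeFn_toLp _).trans ?_
  refine EventuallyEq.trans ?_ (Lp.coeFn_smul _ _).symm
  have h1 : ((∑ k ∈ Finset.range n, (hf.comp_measurePreserving (hτ.iterate k)).toLp :
      Lp ℝ 2 μ) : α → ℝ) =ᵐ[μ] ∑ k ∈ Finset.range n, f ∘ τ^[k] := by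
    refine (Lp.coeFn_finsetSum _ _).trans ?_
    have : ∀ᵐ x ∂μ, ∀ k, (hf.comp_measurePreserving (hτ.iterate k)).toLp (f ∘ τ^[k]) x = (f ∘ τ^[k]) x :=
      ae_all_iff.2 fun k => MemLp.coeFn_toLp _
    filter_upwards [this] with x hx
    simp only [Finset.sum_apply]
    exact Finset.sum_congr rfl fun k _ => hx k
  filter_upwards [h1] with x hx
  rw [Pi.smul_apply, hx]
  simp [birkhoffAverage, birkhoffSum]

/-- By von Neumann the averages converge in `L²` to the projection of `f` on the fixed vectors of
the Koopman operator. That projection is invariant, hence constant by ergodicity, and integrating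
identifies the constant. -/
theorem tendsto_eLpNorm_birkhoffAverage_sub_integral_of_memLp_two [IsProbabilityMeasure μ]
    (hτ : Ergodic τ μ) {f : α → ℝ} (hf : MemLp f 2 μ) :
    Tendsto (fun n => eLpNorm (fun x => birkhoffAverage ℝ τ f n x - ∫ y, f y ∂μ) 1 μ) atTop
      (𝓝 0) := by
  have hm := hτ.toMeasurePreserving
  set U := (Lp.compMeasurePreservingₗᵢ ℝ (p := 2) (E := ℝ) τ hm).toContinuousLinearMap with hU
  have hlim := U.tendsto_birkhoffAverage_orthogonalProjection
    (LinearIsometry.norm_toContinuousLinearMap_le _) hf.toLp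
  set g : Lp ℝ 2 μ := (((U : Lp ℝ 2 μ →ₗ[ℝ] Lp ℝ 2 μ).eqLocus
    (1 : Lp ℝ 2 μ →L[ℝ] Lp ℝ 2 μ)).orthogonalProjectionOnto hf.toLp : Lp ℝ 2 μ) with hg
  have hfix : U g = g :=
    (((U : Lp ℝ 2 μ →ₗ[ℝ] Lp ℝ 2 μ).eqLocus
      (1 : Lp ℝ 2 μ →L[ℝ] Lp ℝ 2 μ)).orthogonalProjectionOnto hf.toLp).2
  have hcomp : g ∘ τ =ᵐ[μ] g := by
    have := Lp.coeFn_compMeasurePreserving g hm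
    refine this.symm.trans ?_
    have h2 : Lp.compMeasurePreserving τ hm g = g := hfix
    rw [h2]
  obtain ⟨C, hC⟩ := hτ.ae_eq_const_of_ae_eq_comp_ae (Lp.aestronglyMeasurable g) hcomp
  have h2 : Tendsto (fun n => eLpNorm (fun x => birkhoffAverage ℝ τ f n x - C) 2 μ) atTop
      (𝓝 0) := by
    have := (Lp.tendsto_Lp_iff_tendsto_eLpNorm' _ _).1 hlim
    refine this.congr fun n => ?_
    have e := toLp_birkhoffAverage hm hf n
    refine eLpNorm_congr_ae ?_
    have e2 : ((birkhoffAverage ℝ U id n hf.toLp : Lp ℝ 2 μ) : α → ℝ) =ᵐ[μ] birkhoffAverage ℝ τ f n := by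
      have e3 := MemLp.coeFn_toLp (memLp_birkhoffAverage hm hf n)
      rw [e] at e3
      exact e3
    filter_upwards [e2, hC] with x h1 h2
    simp only [Pi.sub_apply, h1, h2, Function.const_apply]
  have h1 : Tendsto (fun n => eLpNorm (fun x => birkhoffAverage ℝ τ f n x - C) 1 μ) atTop
      (𝓝 0) := by
    refine tendsto_of_tendsto_of_tendsto_of_le_of_le tendsto_const_nhds h2
      (fun _ => zero_le) fun n => ?_
    exact eLpNorm_le_eLpNorm_of_exponent_le (by norm_num)
      ((memLp_birkhoffAverage hm hf n).sub (memLp_const C)).1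
  have hint : ∀ n ≠ 0, ∫ x, birkhoffAverage ℝ τ f n x ∂μ = ∫ x, f x ∂μ := by
    intro n hn
    have hfi : Integrable f μ := hf.integrable (by norm_num)
    simp only [birkhoffAverage, birkhoffSum, smul_eq_mul]
    rw [integral_const_mul, integral_finsetSum (f := fun k x => f (τ^[k] x)) _ fun k _ =>
      (hm.iterate k).integrable_comp_of_integrable hfi]
    have : ∀ k, ∫ x, f (τ^[k] x) ∂μ = ∫ x, f x ∂μ := by
      intro k
      have h3 := integral_map (μ := μ) (hm.iterate k).aemeasurable (f := f)
        (by rw [(hm.iterate k).map_eq]; exact hf.1)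
      rw [(hm.iterate k).map_eq] at h3
      exact h3.symm
    simp [this, hn]
  have hCeq : C = ∫ x, f x ∂μ := by
    have hl : Tendsto (fun n => ∫ x, birkhoffAverage ℝ τ f n x ∂μ) atTop (𝓝 (∫ _, C ∂μ)) := by
      refine tendsto_integral_of_L1' _ aestronglyMeasurable_const (Eventually.of_forall fun n =>
        (memLp_birkhoffAverage hm hf n).integrable (by norm_num)) h1
    simp only [integral_const, probReal_univ, one_smul] at hl
    refine tendsto_nhds_unique hl (tendsto_const_nhds.congr' ?_)
    filter_upwards [eventually_ne_atTop 0] with n hn using (hint n hn).symm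
  rwa [hCeq] at h1

/-- **Mean ergodic theorem** in `L¹`. -/
theorem tendsto_eLpNorm_birkhoffAverage_sub_integral [IsProbabilityMeasure μ]
    (hτ : Ergodic τ μ) {f : α → ℝ} (hf : Integrable f μ) :
    Tendsto (fun n => eLpNorm (fun x => birkhoffAverage ℝ τ f n x - ∫ y, f y ∂μ) 1 μ) atTop
      (𝓝 0) := by
  have hm := hτ.toMeasurePreserving
  rw [ENNReal.tendsto_nhds_zero]
  intro ε hε
  have hε3 : ε / 3 ≠ 0 := (ENNReal.div_pos hε.ne' (by norm_num)).ne'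
  -- Simple functions lie in `L²` and are dense in `L¹`. Averaging does not increase the `L¹` norm,
  -- so three errors of `ε / 3` suffice.
  obtain ⟨g, hgε, hg⟩ := (memLp_one_iff_integrable.2 hf).exists_simpleFunc_eLpNorm_sub_lt
    ENNReal.one_ne_top hε3
  have hg1 : Integrable g μ := memLp_one_iff_integrable.1 hg
  have hg2 : MemLp g 2 μ := g.memLp_of_isFiniteMeasure 2 μ
  filter_upwards [(ENNReal.tendsto_nhds_zero.1
    (tendsto_eLpNorm_birkhoffAverage_sub_integral_of_memLp_two hτ hg2)) (ε / 3)
    (pos_iff_ne_zero.2 hε3)] with n hn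
  have hfg : MemLp (f - (g : α → ℝ)) 1 μ := memLp_one_iff_integrable.2 (hf.sub hg1)
  have e : (fun x => birkhoffAverage ℝ τ f n x - ∫ y, f y ∂μ) =
      (birkhoffAverage ℝ τ (f - (g : α → ℝ)) n + fun x => birkhoffAverage ℝ τ g n x - ∫ y, g y ∂μ) +
        fun _ => ∫ y, g y ∂μ - ∫ y, f y ∂μ := by
    ext x
    simp only [Pi.add_apply, birkhoffAverage, birkhoffSum, Pi.sub_apply, Finset.sum_sub_distrib,
      smul_sub]
    ring
  have h3 : eLpNorm (fun _ : α => ∫ y, g y ∂μ - ∫ y, f y ∂μ) 1 μ ≤ ε / 3 := by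
    rw [eLpNorm_const _ one_ne_zero (IsProbabilityMeasure.ne_zero μ)]
    simp only [measure_univ, ENNReal.one_rpow, mul_one]
    rw [← integral_sub hg1 hf]
    refine (enorm_integral_le_lintegral_enorm _).trans ?_
    refine le_trans (le_of_eq ?_) hgε.le
    rw [eLpNorm_one_eq_lintegral_enorm]
    refine lintegral_congr fun x => ?_
    rw [Pi.sub_apply, ← enorm_neg, neg_sub]
  rw [e]
  have hA : MemLp (birkhoffAverage ℝ τ (f - (g : α → ℝ)) n) 1 μ := memLp_birkhoffAverage hm hfg n
  have hB : MemLp (fun x => birkhoffAverage ℝ τ g n x - ∫ y, g y ∂μ) 1 μ :=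
    (memLp_birkhoffAverage hm hg n).sub (memLp_const _)
  calc _ ≤ eLpNorm (birkhoffAverage ℝ τ (f - (g : α → ℝ)) n) 1 μ +
        eLpNorm (fun x => birkhoffAverage ℝ τ g n x - ∫ y, g y ∂μ) 1 μ +
        eLpNorm (fun _ : α => ∫ y, g y ∂μ - ∫ y, f y ∂μ) 1 μ :=
        (eLpNorm_add_le (hA.add hB).1 aestronglyMeasurable_const le_rfl).trans
          (add_le_add_left (eLpNorm_add_le hA.1 hB.1 le_rfl) _)
    _ ≤ ε / 3 + ε / 3 + ε / 3 := by
        gcongr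
        exact (eLpNorm_birkhoffAverage_le hm hfg.1 n).trans hgε.le
    _ = ε := ENNReal.add_thirds ε

end MeanErgodic

/-! ### Averages of stationary ergodic sequences. -/

section Stationary

variable {Ω : Type*} [MeasurableSpace Ω] {P : Measure Ω} {Y : ℕ → Ω → ℝ≥0∞}

theorem iterate_shift_apply {E : Type*} (n j : ℕ) (y : ℕ → E) :
    (fun (y : ℕ → E) (j : ℕ) => y (j + 1))^[n] y j = y (n + j) := by
  induction n generalizing j with
  | zero => simp
  | succ n ih =>
    rw [Function.iterate_succ_apply', ih]
    congr 1
    ring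

theorem measurePreserving_shift {E : Type*} [MeasurableSpace E] {Y : ℕ → Ω → E}
    (hY : ∀ j, Measurable (Y j))
    (hstat : P.map (fun ω j => Y (j + 1) ω) = P.map (fun ω j => Y j ω)) :
    MeasurePreserving (fun (y : ℕ → E) (j : ℕ) => y (j + 1)) (P.map fun ω j => Y j ω)
      (P.map fun ω j => Y j ω) := by
  have hs : Measurable fun (y : ℕ → E) (j : ℕ) => y (j + 1) :=
    measurable_pi_lambda _ fun j => measurable_pi_apply _
  refine ⟨hs, ?_⟩
  rw [Measure.map_map hs (measurable_pi_lambda _ hY)]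
  exact hstat

/-- The averages are Birkhoff averages of the zeroth coordinate for the shift on sequence space
under the law of `Y`; stationarity makes the shift measure preserving. -/
theorem tendstoInMeasure_average_of_ergodic [IsProbabilityMeasure P]
    (hY : ∀ j, Measurable (Y j))
    (hstat : P.map (fun ω j => Y (j + 1) ω) = P.map (fun ω j => Y j ω))
    (herg : IsErgodicSeq Y P) (hint : ∫⁻ ω, Y 0 ω ∂P ≠ ∞) :
    TendstoInMeasure P (fun (n : ℕ) ω => (n : ℝ)⁻¹ * ∑ j ∈ Finset.range n, (Y j ω).toReal) atTop
      (fun _ => (∫⁻ ω, Y 0 ω ∂P).toReal) := by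
  have hYm : Measurable fun ω j => Y j ω := measurable_pi_lambda _ hY
  have hτ : Ergodic (fun (y : ℕ → ℝ≥0∞) (j : ℕ) => y (j + 1)) (P.map fun ω j => Y j ω) :=
    ⟨measurePreserving_shift hY hstat, herg⟩
  have : IsProbabilityMeasure (P.map fun ω j => Y j ω) :=
    Measure.isProbabilityMeasure_map hYm.aemeasurable
  set f : (ℕ → ℝ≥0∞) → ℝ := fun y => (y 0).toReal with hf
  have hfm : Measurable f := (measurable_pi_apply 0).ennreal_toReal
  have hfi : Integrable f (P.map fun ω j => Y j ω) := by
    rw [integrable_map_measure hfm.aestronglyMeasurable hYm.aemeasurable]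
    exact integrable_toReal_of_lintegral_ne_top (hY 0).aemeasurable hint
  have hfint : ∫ y, f y ∂(P.map fun ω j => Y j ω) = (∫⁻ ω, Y 0 ω ∂P).toReal := by
    rw [integral_map hYm.aemeasurable hfm.aestronglyMeasurable]
    exact integral_toReal (hY 0).aemeasurable (ae_lt_top (hY 0) hint)
  have hlim := tendsto_eLpNorm_birkhoffAverage_sub_integral hτ hfi
  have hb : ∀ n, Measurable (birkhoffAverage ℝ (fun (y : ℕ → ℝ≥0∞) (j : ℕ) => y (j + 1)) f n) := by
    intro n
    have : birkhoffAverage ℝ (fun (y : ℕ → ℝ≥0∞) (j : ℕ) => y (j + 1)) f n = fun y =>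
        (n : ℝ)⁻¹ * ∑ k ∈ Finset.range n, f ((fun (y : ℕ → ℝ≥0∞) (j : ℕ) => y (j + 1))^[k] y) := by
      ext y; simp [birkhoffAverage, birkhoffSum]
    rw [this]
    exact (Finset.measurable_fun_sum _ fun k _ => hfm.comp (hτ.measurable.iterate k)).const_mul _
  refine tendstoInMeasure_of_tendsto_eLpNorm one_ne_zero (fun n => ?_)
    aestronglyMeasurable_const ?_
  · exact ((Finset.measurable_fun_sum _ fun j _ =>
      (hY j).ennreal_toReal).const_mul _).aestronglyMeasurable
  · refine hlim.congr fun n => ?_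
    rw [eLpNorm_map_measure ((hb n).sub_const _).aestronglyMeasurable hYm.aemeasurable, hfint]
    congr 1
    ext ω
    simp only [Function.comp_apply, birkhoffAverage, birkhoffSum, hf, iterate_shift_apply,
      Pi.sub_apply, smul_eq_mul, add_zero]

end Stationary

/-! ### Stationarity and scaling of the truncated variation in law. -/

section TruncVarLaw

variable {Ω : Type*} [MeasurableSpace Ω] {P : Measure Ω} {X : ℝ≥0 → Ω → ℝ} {β : ℝ}

theorem measurable_truncVar_process (hmeas : ∀ t, Measurable (X t))
    (hcadlag : ∀ ω, IsCadlag (fun t => X t ω)) (c : ℝ) {s t : ℝ≥0} (hst : s ≤ t) :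
    Measurable fun ω => truncVar (fun r => X r ω) c s t := by
  have : (fun ω => truncVar (fun r => X r ω) c s t) = fun ω =>
      truncVarOn (ratPoints s t) c s t (fun r => X r ω) :=
    funext fun ω => truncVar_eq_truncVarOn (fun r => (hcadlag ω r).1) c hst
  rw [this]
  exact (measurable_truncVarOn (countable_ratPoints s t) c s t).comp
    (measurable_pi_lambda _ hmeas)

theorem IsCadlag.continuousWithinAt_comp {x : ℝ≥0 → ℝ} (hx : IsCadlag x) {φ : ℝ≥0 → ℝ≥0}
    (hφ : StrictMono φ) (hc : Continuous φ) (t : ℝ≥0) :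
    ContinuousWithinAt (fun r => x (φ r)) (Ioi t) t :=
  (hx (φ t)).1.comp hc.continuousWithinAt fun _ hr => hφ hr

theorem partialSum_sub (n : ℕ) (g : Fin (n + 1) → ℝ) (i : Fin (n + 1)) :
    Fin.partialSum (fun j : Fin n => g j.succ - g j.castSucc) i = g i - g 0 := by
  induction i using Fin.induction with
  | zero => simp
  | succ i ih => rw [Fin.partialSum_succ, ih]; ring

theorem measurable_partialSum (n : ℕ) (i : Fin (n + 1)) :
    Measurable fun d : Fin n → ℝ => Fin.partialSum d i := by
  induction i using Fin.induction with
  | zero => simp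
  | succ i ih =>
    simp only [Fin.partialSum_succ]
    exact ih.add (measurable_pi_apply i)

/-- Finite-dimensional laws determine the law of the process. Sort the finite set of times; each `X
t - X 0` is then a partial sum of consecutive increments, whose joint law is shift invariant. -/
theorem identDistrib_shift [IsFiniteMeasure P] (hmeas : ∀ t, Measurable (X t))
    (hstat : HasStationaryIncrements X P) {h : ℝ≥0} (hh : 0 < h) :
    IdentDistrib (fun ω (t : ℝ≥0) => X t ω - X 0 ω) (fun ω (t : ℝ≥0) => X (t + h) ω - X h ω)
      P P := by
  classical
  refine (identDistrib_iff_forall_finset_identDistrib (X := fun t ω => X t ω - X 0 ω)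
    (Y := fun t ω => X (t + h) ω - X h ω)
    (measurable_pi_lambda _ fun t => (hmeas t).sub (hmeas 0)).aemeasurable
    (measurable_pi_lambda _ fun t => (hmeas _).sub (hmeas h)).aemeasurable).2 fun I => ?_
  -- Time `0` is added so that the partial sums start from `X 0`.
  obtain ⟨n, hn⟩ : ∃ n, (insert 0 I : Finset ℝ≥0).card = n + 1 :=
    Nat.exists_eq_succ_of_ne_zero (Finset.card_ne_zero_of_mem (Finset.mem_insert_self 0 I))
  set t := (insert 0 I : Finset ℝ≥0).orderEmbOfFin hn with ht
  have hsurj : ∀ s ∈ (insert 0 I : Finset ℝ≥0), ∃ i, t i = s := by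
    intro s hs
    have : s ∈ Set.range t := by
      rw [ht, Finset.range_orderEmbOfFin]; exact hs
    exact this
  have ht0 : t 0 = 0 := by
    obtain ⟨i, hi⟩ := hsurj 0 (Finset.mem_insert_self _ _)
    exact le_antisymm (hi ▸ t.monotone (Fin.zero_le i)) zero_le
  choose idx hidx using fun s : I => hsurj s (Finset.mem_insert_of_mem s.2)
  have hΦ : Measurable fun (d : Fin n → ℝ) (s : I) => Fin.partialSum d (idx s) :=
    measurable_pi_lambda _ fun s => measurable_partialSum n (idx s)
  convert (hstat n t t.strictMono h hh).comp hΦ using 1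
  · ext ω s
    have := partialSum_sub n (fun i => X (t i) ω) (idx s)
    simp [this, hidx, ht0]
  · ext ω s
    have := partialSum_sub n (fun i => X (t i + h) ω) (idx s)
    simp [this, hidx, ht0]

theorem truncVar_sub_const (x : ℝ≥0 → ℝ) (b c : ℝ) (s t : ℝ≥0) :
    truncVar (fun r => x r - b) c s t = truncVar x c s t := by
  simpa using truncVar_shift x b c s t 0

theorem truncVarOn_sub_eq {x : ℝ≥0 → ℝ} (hx : IsCadlag x) (b c : ℝ) {s t : ℝ≥0} (hst : s ≤ t) :
    truncVarOn (ratPoints s t) c s t (fun r => x r - b) = truncVar x c s t := by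
  rw [← truncVar_eq_truncVarOn (fun r => (hx r).1.sub_const b) c hst, truncVar_sub_const]

theorem truncVarOn_shift_eq {x : ℝ≥0 → ℝ} (hx : IsCadlag x) (b c : ℝ) {s t : ℝ≥0} (hst : s ≤ t)
    (h : ℝ≥0) :
    truncVarOn (ratPoints s t) c s t (fun r => x (r + h) - b) =
      truncVar x c (s + h) (t + h) := by
  rw [← truncVar_eq_truncVarOn (fun r => ((hx.continuousWithinAt_comp
    (add_left_strictMono (a := h)) (by fun_prop) r).sub_const b)) c hst, truncVar_shift]

theorem lintegral_truncVar_shift [IsFiniteMeasure P] (hmeas : ∀ t, Measurable (X t))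
    (hcadlag : ∀ ω, IsCadlag (fun t => X t ω)) (hstat : HasStationaryIncrements X P)
    (c : ℝ) {s t : ℝ≥0} (hst : s ≤ t) (h : ℝ≥0) :
    ∫⁻ ω, truncVar (fun r => X r ω) c (s + h) (t + h) ∂P =
      ∫⁻ ω, truncVar (fun r => X r ω) c s t ∂P := by
  rcases eq_or_ne h 0 with rfl | hh
  · simp
  have key := (identDistrib_shift hmeas hstat (pos_iff_ne_zero.2 hh)).comp
    (measurable_truncVarOn (countable_ratPoints s t) c s t)
  have h1 := key.lintegral_eq
  simp only [Function.comp_def, truncVarOn_sub_eq (hcadlag _) _ c hst,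
    truncVarOn_shift_eq (hcadlag _) _ c hst] at h1
  exact h1.symm

/-- Moving on by one block shifts the path by `k`, and the truncated variation ignores the
subtracted constants `X 0` and `X k`. -/
theorem map_truncVar_blocks [IsFiniteMeasure P] (hmeas : ∀ t, Measurable (X t))
    (hcadlag : ∀ ω, IsCadlag (fun t => X t ω)) (hstat : HasStationaryIncrements X P)
    (c : ℝ) {k : ℕ} (hk : 1 ≤ k) :
    P.map (fun ω (j : ℕ) => truncVar (fun t => X t ω) c (((j + 1) * k : ℕ) : ℝ≥0)
        (((j + 1 + 1) * k : ℕ) : ℝ≥0)) =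
      P.map (fun ω (j : ℕ) => truncVar (fun t => X t ω) c ((j * k : ℕ) : ℝ≥0)
        (((j + 1) * k : ℕ) : ℝ≥0)) := by
  have hle : ∀ j : ℕ, ((j * k : ℕ) : ℝ≥0) ≤ (((j + 1) * k : ℕ) : ℝ≥0) := fun j => by
    exact_mod_cast Nat.mul_le_mul_right k (Nat.le_succ j)
  have hG : Measurable fun (x : ℝ≥0 → ℝ) (j : ℕ) =>
      truncVarOn (ratPoints ((j * k : ℕ) : ℝ≥0) (((j + 1) * k : ℕ) : ℝ≥0)) c
        ((j * k : ℕ) : ℝ≥0) (((j + 1) * k : ℕ) : ℝ≥0) x :=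
    measurable_pi_lambda _ fun j => measurable_truncVarOn (countable_ratPoints _ _) c _ _
  have hk0 : (0 : ℝ≥0) < k := by exact_mod_cast hk
  have key := ((identDistrib_shift hmeas hstat hk0).comp hG).map_eq
  have e : ∀ j : ℕ, ((j * k : ℕ) : ℝ≥0) + k = (((j + 1) * k : ℕ) : ℝ≥0) := fun j => by
    push_cast; ring
  simp only [Function.comp_def, truncVarOn_sub_eq (hcadlag _) _ c (hle _),
    truncVarOn_shift_eq (hcadlag _) _ c (hle _), e] at key
  exact key.symm

theorem identDistrib_truncVar_scale (hcadlag : ∀ ω, IsCadlag (fun t => X t ω))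
    (hself : IsSelfSimilar X β P) (c : ℝ) {A : ℝ≥0} (hA : 0 < A) (t : ℝ≥0) :
    IdentDistrib (fun ω => truncVar (fun r => X r ω) ((A : ℝ) ^ (-β) * c) 0 t)
      (fun ω => ENNReal.ofReal ((A : ℝ) ^ (-β)) * truncVar (fun r => X r ω) c 0 (A * t)) P P := by
  have ha : 0 ≤ (A : ℝ) ^ (-β) := by positivity
  have key := ((hself A hA).comp (measurable_truncVarOn (countable_ratPoints 0 t)
    ((A : ℝ) ^ (-β) * c) 0 t)).symm
  have h1 : ∀ ω, truncVarOn (ratPoints 0 t) ((A : ℝ) ^ (-β) * c) 0 t (fun r => X r ω) =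
      truncVar (fun r => X r ω) ((A : ℝ) ^ (-β) * c) 0 t := fun ω =>
    (truncVar_eq_truncVarOn (fun r => (hcadlag ω r).1) _ zero_le).symm
  have h2 : ∀ ω, truncVarOn (ratPoints 0 t) ((A : ℝ) ^ (-β) * c) 0 t
      (fun r => (A : ℝ) ^ (-β) * X (A * r) ω) =
      ENNReal.ofReal ((A : ℝ) ^ (-β)) * truncVar (fun r => X r ω) c 0 (A * t) := fun ω => by
    rw [← truncVar_eq_truncVarOn (fun r => ((hcadlag ω).continuousWithinAt_comp
        (fun _ _ hab => mul_lt_mul_of_pos_left hab hA) (by fun_prop) r).const_mul ((A : ℝ) ^ (-β))) _ zero_le,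
      truncVar_const_mul (fun r => X (A * r) ω) ha,
      truncVar_comp_mul (fun r => X r ω) c 0 t hA.ne', mul_zero]
  simpa only [Function.comp_def, h1, h2] using key

end TruncVarLaw

/-! ### The law of large numbers for `TV^1`. -/

/-- Comparing `a k` and `a l` through `a (k * l)` gives `a l / l ≤ (a k + 1) / k` for all positive
`k` and `l`. So `C` can be the supremum of the left-hand sides. -/
theorem exists_slope {a : ℕ → ℝ} (h1 : ∀ n k : ℕ, n * a k ≤ a (n * k))
    (h2 : ∀ n k : ℕ, a (n * k) ≤ n * a k + n) :
    ∃ C : ℝ, ∀ k : ℕ, 1 ≤ k → a k ≤ C * k ∧ C * k ≤ a k + 1 := by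
  have key : ∀ k l : ℕ, a (l + 1) / ((l + 1 : ℕ) : ℝ) ≤ (a (k + 1) + 1) / ((k + 1 : ℕ) : ℝ) := by
    intro k l
    rw [div_le_div_iff₀ (by positivity) (by positivity)]
    have e1 := h1 (k + 1) (l + 1)
    have e2 := h2 (l + 1) (k + 1)
    rw [mul_comm (l + 1) (k + 1)] at e2
    nlinarith
  have hb : BddAbove (range fun l : ℕ => a (l + 1) / ((l + 1 : ℕ) : ℝ)) :=
    ⟨_, forall_mem_range.2 (key 0)⟩
  refine ⟨⨆ l : ℕ, a (l + 1) / ((l + 1 : ℕ) : ℝ), fun k hk => ?_⟩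
  obtain ⟨k, rfl⟩ := Nat.exists_eq_add_of_le' hk
  constructor
  · rw [← div_le_iff₀ (by positivity)]
    exact le_ciSup hb k
  · rw [← le_div_iff₀ (by positivity)]
    exact ciSup_le (key k)

section TruncVarLaw

variable {Ω : Type*} [MeasurableSpace Ω] {P : Measure Ω} {X : ℝ≥0 → Ω → ℝ} {β : ℝ}

/-- Finitely many translates of `[0, A]` cover `[0, T]`; they have equal expectations, and each cut
costs at most `c`. -/
theorem lintegral_truncVar_ne_top [IsProbabilityMeasure P] (hmeas : ∀ t, Measurable (X t))
    (hcadlag : ∀ ω, IsCadlag (fun t => X t ω)) (hstat : HasStationaryIncrements X P)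
    {c : ℝ} (hc : 0 ≤ c) {A : ℝ≥0} (hA : 0 < A)
    (hint : ∫⁻ ω, truncVar (fun t => X t ω) c 0 A ∂P ≠ ∞) (T : ℝ≥0) :
    ∫⁻ ω, truncVar (fun t => X t ω) c 0 T ∂P ≠ ∞ := by
  obtain ⟨n, hn⟩ := exists_nat_ge (T / A)
  rw [div_le_iff₀ hA] at hn
  have hτ : Monotone fun j : ℕ => (j : ℝ≥0) * A := fun i j hij => by
    have : (i : ℝ≥0) ≤ j := by exact_mod_cast hij
    exact mul_le_mul_left this A
  have hb : ∀ ω, truncVar (fun t => X t ω) c 0 T ≤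
      ∑ j ∈ Finset.range n, truncVar (fun t => X t ω) c (j * A) ((j + 1 : ℕ) * A) +
        n * ENNReal.ofReal c := fun ω =>
    (truncVar_mono_right _ c zero_le hn).trans
      (by simpa using truncVar_le_sum (fun t => X t ω) hc hτ n)
  refine ne_top_of_le_ne_top ?_ (lintegral_mono hb)
  have hm : ∀ j : ℕ, Measurable fun ω =>
      truncVar (fun t => X t ω) c (j * A) ((j + 1 : ℕ) * A) := fun j =>
    measurable_truncVar_process hmeas hcadlag c (hτ (Nat.le_succ j))
  rw [lintegral_add_right _ measurable_const, lintegral_finsetSum _ fun j _ => hm j]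
  have hs : ∀ j : ℕ, ∫⁻ ω, truncVar (fun t => X t ω) c (j * A) ((j + 1 : ℕ) * A) ∂P =
      ∫⁻ ω, truncVar (fun t => X t ω) c 0 A ∂P := fun j => by
    rw [← lintegral_truncVar_shift hmeas hcadlag hstat c zero_le (j * A)]
    congr 2 with ω
    congr 1
    · simp
    · push_cast; ring
  simp only [hs, lintegral_const, measure_univ, mul_one]
  refine ENNReal.add_ne_top.2 ⟨?_, ?_⟩
  · simpa using ENNReal.mul_ne_top (by simp) hint
  · exact ENNReal.mul_ne_top (by simp) ENNReal.ofReal_ne_top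

/-- Scaling makes `TV^c(X,[0,t])` vanish for a sequence `c → 0`, so `X t = X 0`. Self-similarity at
time `0` then gives `X 0 = 0`. -/
theorem eq_zero_of_truncVar_eq_zero [IsProbabilityMeasure P] (hβ : 0 < β)
    (hmeas : ∀ t, Measurable (X t)) (hcadlag : ∀ ω, IsCadlag (fun t => X t ω))
    (hself : IsSelfSimilar X β P)
    (h0 : ∀ k : ℕ, ∀ᵐ ω ∂P, truncVar (fun t => X t ω) 1 0 k = 0) (t : ℝ≥0) :
    ∀ᵐ ω ∂P, X t ω = 0 := by
  have hlim : Tendsto (fun n : ℕ => (((n + 1 : ℕ) : ℝ≥0) : ℝ) ^ (-β)) atTop (𝓝 0) := by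
    have := (tendsto_rpow_neg_atTop hβ).comp
      (tendsto_natCast_atTop_atTop.comp (tendsto_add_atTop_nat 1))
    simpa [Function.comp_def] using this
  have hpos : ∀ n : ℕ, (0 : ℝ≥0) < ((n + 1 : ℕ) : ℝ≥0) := fun n => by positivity
  have hincr : ∀ᵐ ω ∂P, X t ω = X 0 ω := by
    have h1 : ∀ n : ℕ, ∀ᵐ ω ∂P,
        truncVar (fun r => X r ω) ((((n + 1 : ℕ) : ℝ≥0) : ℝ) ^ (-β) * 1) 0 t = 0 := by
      intro n
      obtain ⟨k, hk⟩ := exists_nat_ge (((n + 1 : ℕ) : ℝ≥0) * t)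
      refine (identDistrib_truncVar_scale hcadlag hself 1 (hpos n) t).symm.ae_snd
        (measurableSet_singleton (0 : ℝ≥0∞)) ?_
      filter_upwards [h0 k] with ω hω
      have : truncVar (fun r => X r ω) 1 0 (((n + 1 : ℕ) : ℝ≥0) * t) = 0 :=
        le_antisymm ((truncVar_mono_right _ 1 zero_le hk).trans hω.le) zero_le
      change _ * _ = (0 : ℝ≥0∞)
      rw [this, mul_zero]
    filter_upwards [ae_all_iff.2 h1] with ω hω
    have h2 : ∀ n : ℕ, |X t ω - X 0 ω| ≤ (((n + 1 : ℕ) : ℝ≥0) : ℝ) ^ (-β) := by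
      intro n
      have := (ofReal_abs_sub_le_truncVar (fun r => X r ω)
        ((((n + 1 : ℕ) : ℝ≥0) : ℝ) ^ (-β) * 1) (zero_le (a := t))).trans (hω n).le
      have := ENNReal.ofReal_eq_zero.1 (le_antisymm this zero_le)
      linarith
    have h3 : |X t ω - X 0 ω| ≤ 0 := ge_of_tendsto' hlim h2
    exact sub_eq_zero.1 (abs_nonpos_iff.1 h3)
  have hzero : ∀ᵐ ω ∂P, X 0 ω = 0 := by
    have hid : ∀ n : ℕ, IdentDistrib (fun ω => (((n + 1 : ℕ) : ℝ≥0) : ℝ) ^ (-β) * X 0 ω) (X 0)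
        P P := by
      intro n
      have := (hself _ (hpos n)).comp (measurable_pi_apply (0 : ℝ≥0))
      simpa [Function.comp_def] using this
    have hm : TendstoInMeasure P
        (fun (n : ℕ) ω => (((n + 1 : ℕ) : ℝ≥0) : ℝ) ^ (-β) * X 0 ω) atTop (fun _ => 0) := by
      refine tendstoInMeasure_of_tendsto_ae
        (fun n => ((hmeas 0).const_mul _).aestronglyMeasurable) (ae_of_all _ fun ω => ?_)
      simpa using hlim.mul_const (X 0 ω)
    -- The rescaled variables tend to `0` but all have the law of `X 0`.
    have hconst : TendstoInMeasure P (fun _ : ℕ => X 0) atTop (fun _ => 0) := by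
      rw [tendstoInMeasure_iff_norm] at hm ⊢
      intro ε hε
      refine (hm ε hε).congr fun n => ?_
      have hS : MeasurableSet {y : ℝ | ε ≤ ‖y - 0‖} :=
        measurableSet_le measurable_const ((measurable_id.sub_const 0).norm)
      exact (hid n).measure_mem_eq hS
    have hself' : TendstoInMeasure P (fun _ : ℕ => X 0) atTop (X 0) := fun ε hε => by
      simp [hε.ne']
    exact tendstoInMeasure_ae_unique hself' hconst
  filter_upwards [hincr, hzero] with ω h1 h2 using h1.trans h2

/-- `TV^1` on `[0, T]` lies between the sum of `n` blocks and the sum of `n + 1` blocks plus `n +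
1`. With `a` within `1` of `C * k` and both averages within `1` of `a`, the total error is at most
`2 * n + C * k + 2`; `hδk` and `hδT` bound `2 * n` and `C * k + 2` by `δ * T / 2` each. -/
theorem abs_truncVar_sub_lt (x : ℝ≥0 → ℝ) {k n : ℕ} (hk : 0 < k) {T : ℝ≥0} {a C δ : ℝ}
    (hC : 0 ≤ C) (ha1 : a ≤ C * k) (ha2 : C * k ≤ a + 1)
    (hn1 : ((n * k : ℕ) : ℝ≥0) ≤ T) (hn2 : T ≤ (((n + 1) * k : ℕ) : ℝ≥0))
    (hfin : truncVar x 1 0 (((n + 1) * k : ℕ) : ℝ≥0) ≠ ∞)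
    (h1 : |(n : ℝ)⁻¹ * ∑ j ∈ Finset.range n,
      (truncVar x 1 ((j * k : ℕ) : ℝ≥0) (((j + 1) * k : ℕ) : ℝ≥0)).toReal - a| < 1)
    (h2 : |((n + 1 : ℕ) : ℝ)⁻¹ * ∑ j ∈ Finset.range (n + 1),
      (truncVar x 1 ((j * k : ℕ) : ℝ≥0) (((j + 1) * k : ℕ) : ℝ≥0)).toReal - a| < 1)
    (hδk : 4 < δ * k) (hδT : 2 * (C * k + 2) < δ * T) :
    truncVar x 1 0 T ≠ ∞ ∧ |(truncVar x 1 0 T).toReal - C * T| < δ * T := by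
  have hτ : Monotone fun j : ℕ => ((j * k : ℕ) : ℝ≥0) := fun i j hij =>
    Nat.cast_le.2 (Nat.mul_le_mul_right k hij)
  have hT : truncVar x 1 0 T ≠ ∞ := ne_top_of_le_ne_top hfin (truncVar_mono_right x 1 zero_le hn2)
  refine ⟨hT, ?_⟩
  have hYfin : ∀ j ∈ Finset.range (n + 1),
      truncVar x 1 ((j * k : ℕ) : ℝ≥0) (((j + 1) * k : ℕ) : ℝ≥0) ≠ ∞ := by
    intro j hj
    have hj : j + 1 ≤ n + 1 := Finset.mem_range.1 hj
    refine ne_top_of_le_ne_top hfin ?_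
    exact (le_add_self.trans (truncVar_add_le x 1 zero_le (hτ (Nat.le_succ j)))).trans
      (truncVar_mono_right x 1 zero_le (hτ hj))
  have hYfin' : ∀ j ∈ Finset.range n,
      truncVar x 1 ((j * k : ℕ) : ℝ≥0) (((j + 1) * k : ℕ) : ℝ≥0) ≠ ∞ := fun j hj =>
    hYfin j (Finset.mem_range.2 ((Finset.mem_range.1 hj).trans (Nat.lt_succ_self n)))
  have hlow : ∑ j ∈ Finset.range n,
      (truncVar x 1 ((j * k : ℕ) : ℝ≥0) (((j + 1) * k : ℕ) : ℝ≥0)).toReal ≤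
      (truncVar x 1 0 T).toReal := by
    rw [← ENNReal.toReal_sum hYfin']
    refine ENNReal.toReal_mono hT ?_
    refine le_trans ?_ (truncVar_mono_right x 1 zero_le hn1)
    simpa using sum_truncVar_le x 1 hτ n
  have hup : (truncVar x 1 0 T).toReal ≤ ∑ j ∈ Finset.range (n + 1),
      (truncVar x 1 ((j * k : ℕ) : ℝ≥0) (((j + 1) * k : ℕ) : ℝ≥0)).toReal + (n + 1 : ℕ) := by
    have hs := ENNReal.sum_ne_top.2 hYfin
    have e : (∑ j ∈ Finset.range (n + 1),
        (truncVar x 1 ((j * k : ℕ) : ℝ≥0) (((j + 1) * k : ℕ) : ℝ≥0)) +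
          ((n + 1 : ℕ) : ℝ≥0∞)).toReal = _ :=
      ENNReal.toReal_add hs (ENNReal.natCast_ne_top _)
    rw [ENNReal.toReal_sum hYfin, ENNReal.toReal_natCast] at e
    rw [← e]
    refine ENNReal.toReal_mono (ENNReal.add_ne_top.2 ⟨hs, ENNReal.natCast_ne_top _⟩) ?_
    refine (truncVar_mono_right x 1 zero_le hn2).trans ?_
    simpa using truncVar_le_sum x zero_le_one hτ (n + 1)
  set F := (truncVar x 1 0 T).toReal
  set S := ∑ j ∈ Finset.range n,
    (truncVar x 1 ((j * k : ℕ) : ℝ≥0) (((j + 1) * k : ℕ) : ℝ≥0)).toReal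
  set S' := ∑ j ∈ Finset.range (n + 1),
    (truncVar x 1 ((j * k : ℕ) : ℝ≥0) (((j + 1) * k : ℕ) : ℝ≥0)).toReal
  have hS0 : 0 ≤ S := Finset.sum_nonneg fun j _ => ENNReal.toReal_nonneg
  have hn1' : (n : ℝ) * k ≤ T := by exact_mod_cast hn1
  have hn2' : (T : ℝ) ≤ (n + 1) * k := by exact_mod_cast hn2
  have hS : n * (a - 1) ≤ S := by
    -- For `n = 0` the average in `h1` is `0` by convention and says nothing about `S`.
    rcases Nat.eq_zero_or_pos n with hn | hn
    · simpa [hn] using hS0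
    · have hn' : (0 : ℝ) < n := by exact_mod_cast hn
      have h3 := (abs_lt.1 h1).1
      have h4 : a - 1 ≤ S / n := by rw [div_eq_inv_mul]; linarith
      rwa [le_div_iff₀ hn', mul_comm] at h4
  have hS' : S' ≤ (n + 1) * (a + 1) := by
    have hn' : (0 : ℝ) < ((n + 1 : ℕ) : ℝ) := by positivity
    have h3 := (abs_lt.1 h2).2
    have h4 : S' / ((n + 1 : ℕ) : ℝ) ≤ a + 1 := by rw [div_eq_inv_mul]; linarith
    rw [div_le_iff₀ hn', mul_comm] at h4
    exact_mod_cast h4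
  have hk' : (0 : ℝ) < k := by exact_mod_cast hk
  have hδ : 0 < δ := by
    by_contra h
    nlinarith
  have hn0 : (0 : ℝ) ≤ n := Nat.cast_nonneg n
  have hnT : 4 * (n : ℝ) ≤ δ * T := by
    calc 4 * (n : ℝ) ≤ δ * k * n := by gcongr
      _ = δ * (n * k) := by ring
      _ ≤ δ * T := by gcongr
  have hCT1 : C * (n * k) ≤ C * T := by gcongr
  have hCT2 : C * T ≤ C * ((n + 1) * k) := by gcongr
  push_cast at hup
  have hna1 : (n : ℝ) * (C * k) ≤ n * (a + 1) := by gcongr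
  have hna2 : ((n : ℝ) + 1) * a ≤ (n + 1) * (C * k) := by gcongr
  rw [abs_lt]
  constructor <;> nlinarith

theorem exists_tendsto_measure_truncVar [IsProbabilityMeasure P] (hβ : 0 < β)
    (hmeas : ∀ t, Measurable (X t)) (hcadlag : ∀ ω, IsCadlag (fun t => X t ω))
    (hself : IsSelfSimilar X β P) (hstat : HasStationaryIncrements X P)
    (hne : ¬ ∀ t, ∀ᵐ ω ∂P, X t ω = 0)
    (hint : ∀ T, ∫⁻ ω, truncVar (fun t => X t ω) 1 0 T ∂P ≠ ∞)
    (herg : ∀ k : ℕ, 1 ≤ k → IsErgodicSeq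
      (fun (j : ℕ) ω => truncVar (fun t => X t ω) 1 ((j * k : ℕ) : ℝ≥0) (((j + 1) * k : ℕ) : ℝ≥0))
      P) :
    ∃ C : ℝ, 0 < C ∧ ∀ δ : ℝ, 0 < δ → Tendsto (fun T : ℝ≥0 =>
      P {ω | ¬ (truncVar (fun t => X t ω) 1 0 T ≠ ∞ ∧
        |(truncVar (fun t => X t ω) 1 0 T).toReal - C * T| < δ * T)}) atTop (𝓝 0) := by
  have hle : ∀ j k : ℕ, ((j * k : ℕ) : ℝ≥0) ≤ (((j + 1) * k : ℕ) : ℝ≥0) := fun j k => by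
    exact_mod_cast Nat.mul_le_mul_right k (Nat.le_succ j)
  have hYm : ∀ k j : ℕ, Measurable fun ω => truncVar (fun t => X t ω) 1 ((j * k : ℕ) : ℝ≥0)
      (((j + 1) * k : ℕ) : ℝ≥0) := fun k j =>
    measurable_truncVar_process hmeas hcadlag 1 (hle j k)
  have hFm : ∀ T : ℝ≥0, Measurable fun ω => truncVar (fun t => X t ω) 1 0 T := fun T =>
    measurable_truncVar_process hmeas hcadlag 1 zero_le
  set a : ℕ → ℝ := fun k => (∫⁻ ω, truncVar (fun t => X t ω) 1 0 k ∂P).toReal with ha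
  have hblock : ∀ j k : ℕ, ∫⁻ ω, truncVar (fun t => X t ω) 1 ((j * k : ℕ) : ℝ≥0)
      (((j + 1) * k : ℕ) : ℝ≥0) ∂P = ∫⁻ ω, truncVar (fun t => X t ω) 1 0 k ∂P := fun j k => by
    rw [← lintegral_truncVar_shift hmeas hcadlag hstat 1 zero_le ((j * k : ℕ) : ℝ≥0)]
    congr 2 with ω
    congr 1
    · simp
    · push_cast; ring
  have hτ : ∀ k : ℕ, Monotone fun j : ℕ => ((j * k : ℕ) : ℝ≥0) := fun k i j hij =>
    Nat.cast_le.2 (Nat.mul_le_mul_right k hij)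
  have hsum : ∀ n k : ℕ, ∫⁻ ω, ∑ j ∈ Finset.range n, truncVar (fun t => X t ω) 1
      ((j * k : ℕ) : ℝ≥0) (((j + 1) * k : ℕ) : ℝ≥0) ∂P =
      n * ∫⁻ ω, truncVar (fun t => X t ω) 1 0 k ∂P := fun n k => by
    rw [lintegral_finsetSum _ fun j _ => hYm k j]
    simp only [hblock, Finset.sum_const, Finset.card_range, nsmul_eq_mul]
  obtain ⟨C, hCa⟩ := exists_slope (a := a)
    (fun n k => by
      have h : (n : ℝ≥0∞) * ∫⁻ ω, truncVar (fun t => X t ω) 1 0 k ∂P ≤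
          ∫⁻ ω, truncVar (fun t => X t ω) 1 0 ((n * k : ℕ) : ℝ≥0) ∂P := by
        rw [← hsum]
        exact lintegral_mono fun ω => by simpa using sum_truncVar_le (fun t => X t ω) 1 (hτ k) n
      simpa [ha, ENNReal.toReal_mul] using ENNReal.toReal_mono (hint _) h)
    (fun n k => by
      have h : ∫⁻ ω, truncVar (fun t => X t ω) 1 0 ((n * k : ℕ) : ℝ≥0) ∂P ≤
          (n : ℝ≥0∞) * ∫⁻ ω, truncVar (fun t => X t ω) 1 0 k ∂P + n := by
        calc _ ≤ ∫⁻ ω, (∑ j ∈ Finset.range n, truncVar (fun t => X t ω) 1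
                ((j * k : ℕ) : ℝ≥0) (((j + 1) * k : ℕ) : ℝ≥0) + n) ∂P :=
              lintegral_mono fun ω => by
                simpa using truncVar_le_sum (fun t => X t ω) zero_le_one (hτ k) n
          _ = _ := by
              rw [lintegral_add_right _ measurable_const, hsum]
              simp
      have hm : (n : ℝ≥0∞) * ∫⁻ ω, truncVar (fun t => X t ω) 1 0 k ∂P ≠ ∞ :=
        ENNReal.mul_ne_top (ENNReal.natCast_ne_top n) (hint _)
      have h' := ENNReal.toReal_mono (ENNReal.add_ne_top.2 ⟨hm, ENNReal.natCast_ne_top n⟩) h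
      rw [ENNReal.toReal_add hm (ENNReal.natCast_ne_top n)] at h'
      simpa [ha, ENNReal.toReal_mul] using h')
  have ha0 : ∀ k, 0 ≤ a k := fun k => ENNReal.toReal_nonneg
  have hCpos : 0 < C := by
    by_contra hC
    refine hne (eq_zero_of_truncVar_eq_zero hβ hmeas hcadlag hself fun k => ?_)
    have hk : a k = 0 := by
      rcases Nat.eq_zero_or_pos k with rfl | hk
      · simp [ha, truncVar_self]
      · have hk' : (0 : ℝ) < k := by exact_mod_cast hk
        have := (hCa k hk).1
        have := ha0 k
        nlinarith
    have h0 : ∫⁻ ω, truncVar (fun t => X t ω) 1 0 k ∂P = 0 :=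
      ((ENNReal.toReal_eq_zero_iff _).1 hk).resolve_right (hint _)
    exact (lintegral_eq_zero_iff (hFm k)).1 h0
  refine ⟨C, hCpos, fun δ hδ => ?_⟩
  -- The block length depends on `δ` alone and stays fixed while `T → ∞`.
  obtain ⟨k, hk⟩ := exists_nat_gt (4 / δ)
  have hk0 : 0 < k := by
    have : (0 : ℝ) < k := lt_trans (by positivity) hk
    exact_mod_cast this
  have hkR : (0 : ℝ≥0) < k := by exact_mod_cast hk0
  rw [div_lt_iff₀ hδ, mul_comm (k : ℝ)] at hk
  have hinm := (tendstoInMeasure_iff_dist.1 (tendstoInMeasure_average_of_ergodic (hYm k)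
    (map_truncVar_blocks hmeas hcadlag hstat 1 hk0) (herg k hk0)
    (by rw [hblock]; exact hint _))) 1 one_pos
  rw [hblock] at hinm
  have hfl : Tendsto (fun T : ℝ≥0 => ⌊T / k⌋₊) atTop atTop :=
    tendsto_nat_floor_atTop.comp (tendsto_id.atTop_div_const hkR)
  -- The bad event needs one of the averages over `n` and `n + 1` blocks to be off by at least `1`,
  -- up to a null set.
  have hlim := (hinm.comp hfl).add ((hinm.comp (tendsto_add_atTop_nat 1)).comp hfl)
  rw [add_zero] at hlim
  refine tendsto_of_tendsto_of_tendsto_of_le_of_le' tendsto_const_nhds hlim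
    (Eventually.of_forall fun _ => zero_le) ?_
  obtain ⟨N, hN⟩ := exists_nat_gt (2 * (C * k + 2) / δ)
  rw [div_lt_iff₀ hδ, mul_comm (N : ℝ)] at hN
  filter_upwards [eventually_ge_atTop (N : ℝ≥0)] with T hT
  have hNT : (N : ℝ) ≤ T := by exact_mod_cast hT
  have hδT : 2 * (C * k + 2) < δ * T := hN.trans_le (by gcongr)
  set n := ⌊T / k⌋₊ with hn
  have hn1 : ((n * k : ℕ) : ℝ≥0) ≤ T := by
    push_cast
    rw [← le_div_iff₀ hkR]
    exact Nat.floor_le zero_le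
  have hn2 : T ≤ (((n + 1) * k : ℕ) : ℝ≥0) := by
    push_cast
    rw [← div_le_iff₀ hkR]
    exact (Nat.lt_floor_add_one _).le
  refine le_trans (measure_mono_ae ?_) (measure_union_le _ _)
  filter_upwards [ae_lt_top (hFm (((n + 1) * k : ℕ) : ℝ≥0)) (hint _)] with ω hω hbad
  by_contra hgood
  refine hbad ?_
  have hg := not_or.1 hgood
  exact abs_truncVar_sub_lt (fun t => X t ω) hk0 hCpos.le (hCa k hk0).1 (hCa k hk0).2 hn1 hn2
    hω.ne (not_le.1 hg.1) (not_le.1 hg.2) hk hδT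

theorem edist_ofReal_lt {y : ℝ≥0∞} {b r : ℝ} (hb : 0 ≤ b) (hy : y ≠ ∞) (h : |y.toReal - b| < r) :
    edist y (ENNReal.ofReal b) < ENNReal.ofReal r := by
  lift y to ℝ≥0 using hy
  lift b to ℝ≥0 using hb
  rw [ENNReal.ofReal_coe_nnreal]
  have e : edist (y : ℝ≥0∞) (b : ℝ≥0∞) = edist y b := rfl
  rw [e, edist_dist, NNReal.dist_eq]
  exact (ENNReal.ofReal_lt_ofReal_iff (lt_of_le_of_lt (abs_nonneg _) h)).2 h

end TruncVarLaw

/-! ### Transfer from large times to small truncation levels. -/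

theorem theorem2 {Ω : Type*} [MeasurableSpace Ω] (P : Measure Ω) [IsProbabilityMeasure P]
    (X : ℝ≥0 → Ω → ℝ) (β : ℝ) (hβ : 0 < β)
    (hmeas : ∀ t, Measurable (X t))
    (hcadlag : ∀ ω, IsCadlag (fun t => X t ω))
    (hself : IsSelfSimilar X β P)
    (hstat : HasStationaryIncrements X P)
    -- `X` is not the zero process
    (hne : ¬ ∀ t, ∀ᵐ ω ∂P, X t ω = 0)
    (hint : ∃ c₀ : ℝ, 0 < c₀ ∧ ∫⁻ ω, truncVar (fun t => X t ω) c₀ 0 1 ∂P < ∞)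
    (herg : ∀ k : ℕ, 1 ≤ k →
      IsErgodicSeq
        (fun (j : ℕ) ω => truncVar (fun t => X t ω) 1 ((j * k : ℕ) : ℝ≥0) (((j + 1) * k : ℕ) : ℝ≥0))
        P) :
    ∃ C : ℝ, 0 < C ∧ ∀ t : ℝ≥0,
      TendstoInMeasure P
        (fun (c : ℝ) ω => ENNReal.ofReal (c ^ (1 / β - 1)) * truncVar (fun s => X s ω) c 0 t)
        (𝓝[>] 0) (fun _ => ENNReal.ofReal (C * t)) := by
  obtain ⟨c₀, hc₀, hc₀int⟩ := hint
  -- The time scale `A = c ^ (-1/β)` is the one that turns truncation level `c` into level `1`.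
  have hscale : ∀ c : ℝ, 0 < c → 0 < (c ^ (-β⁻¹)).toNNReal ∧
      (((c ^ (-β⁻¹)).toNNReal : ℝ≥0) : ℝ) = c ^ (-β⁻¹) ∧
      (((c ^ (-β⁻¹)).toNNReal : ℝ≥0) : ℝ) ^ (-β) = c := by
    intro c hc
    have hp : 0 < c ^ (-β⁻¹) := Real.rpow_pos_of_pos hc _
    refine ⟨Real.toNNReal_pos.2 hp, Real.coe_toNNReal _ hp.le, ?_⟩
    rw [Real.coe_toNNReal _ hp.le, ← Real.rpow_mul hc.le]
    simp [hβ.ne']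
  have hint1 : ∀ T, ∫⁻ ω, truncVar (fun t => X t ω) 1 0 T ∂P ≠ ∞ := by
    obtain ⟨hA, -, hAc⟩ := hscale c₀ hc₀
    refine lintegral_truncVar_ne_top hmeas hcadlag hstat zero_le_one hA ?_
    have key := (identDistrib_truncVar_scale hcadlag hself 1 hA 1).lintegral_eq
    rw [hAc, mul_one, mul_one, lintegral_const_mul' _ _ ENNReal.ofReal_ne_top] at key
    rw [key] at hc₀int
    exact (ENNReal.lt_top_of_mul_ne_top_right hc₀int.ne (by simpa using hc₀)).ne
  obtain ⟨C, hC, hlim⟩ := exists_tendsto_measure_truncVar hβ hmeas hcadlag hself hstat hne hint1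
    herg
  refine ⟨C, hC, fun t => ?_⟩
  rcases eq_or_ne t 0 with rfl | ht
  · intro ε hε
    refine tendsto_const_nhds.congr' ?_
    filter_upwards [self_mem_nhdsWithin] with c hc
    have h0 : edist (0 : ℝ≥0∞) 0 = 0 := edist_self (0 : ℝ≥0)
    simp [truncVar_self _ (le_of_lt (mem_Ioi.1 hc)), h0, hε.ne']
  have ht0 : 0 < t := pos_iff_ne_zero.2 ht
  have htR : (0 : ℝ) < t := by exact_mod_cast ht0
  refine tendstoInMeasure_of_ne_top fun ε hε hε' => ?_
  set r := ε.toReal with hr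
  have hr0 : 0 < r := ENNReal.toReal_pos hε.ne' hε'
  have hεr : ε = ENNReal.ofReal r := (ENNReal.ofReal_toReal hε').symm
  have hAt : Tendsto (fun c : ℝ => (c ^ (-β⁻¹)).toNNReal * t) (𝓝[>] 0) atTop := by
    refine Tendsto.atTop_mul_const ht0 (tendsto_real_toNNReal_atTop.comp ?_)
    exact tendsto_rpow_neg_nhdsGT_zero (neg_lt_zero.2 (inv_pos.2 hβ))
  -- At time `T = A * t` the tolerance `(r / t) * T` becomes exactly `r` after division by `A`.
  refine tendsto_of_tendsto_of_tendsto_of_le_of_le' tendsto_const_nhds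
    ((hlim (r / t) (by positivity)).comp hAt) (Eventually.of_forall fun _ => zero_le) ?_
  filter_upwards [self_mem_nhdsWithin] with c hc
  have hc : 0 < c := hc
  obtain ⟨hA, hA1, hA2⟩ := hscale c hc
  set A := (c ^ (-β⁻¹)).toNNReal
  have hAR : (0 : ℝ) < A := by exact_mod_cast hA
  -- The error event is expressed through a fixed measurable set of values, so its probability can
  -- be computed from the rescaled variable with the same law.
  set G : Set ℝ≥0∞ := {y | y ≠ ∞ ∧ |y.toReal - C * t| < r} with hG
  have hGm : MeasurableSet G :=
    (measurableSet_singleton ∞).compl.inter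
      (measurableSet_lt ((measurable_id.ennreal_toReal.sub_const _).norm) measurable_const)
  have hid := (identDistrib_truncVar_scale hcadlag hself 1 hA t).comp
    (measurable_id.const_mul (ENNReal.ofReal (c ^ (1 / β - 1))))
  rw [hA2, mul_one] at hid
  have hcA : ENNReal.ofReal (c ^ (1 / β - 1)) * ENNReal.ofReal c = ENNReal.ofReal (A : ℝ)⁻¹ := by
    rw [← ENNReal.ofReal_mul (by positivity), hA1, ← Real.rpow_neg hc.le, neg_neg]
    congr 1
    nth_rewrite 2 [← Real.rpow_one c]
    rw [← Real.rpow_add hc]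
    congr 1
    ring
  calc _ ≤ P {ω | ENNReal.ofReal (c ^ (1 / β - 1)) * truncVar (fun s => X s ω) c 0 t ∈ Gᶜ} := by
        refine measure_mono fun ω hω hmem => ?_
        exact not_le.2 (hεr ▸ edist_ofReal_lt (by positivity) hmem.1 hmem.2) hω
    _ = P {ω | ENNReal.ofReal (c ^ (1 / β - 1)) *
          (ENNReal.ofReal c * truncVar (fun s => X s ω) 1 0 (A * t)) ∈ Gᶜ} :=
        hid.measure_mem_eq hGm.compl
    _ ≤ _ := by
        refine measure_mono fun ω hω hmem => hω ?_
        simp only at hmem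
        rw [← mul_assoc, hcA]
        refine ⟨ENNReal.mul_ne_top ENNReal.ofReal_ne_top hmem.1, ?_⟩
        rw [ENNReal.toReal_mul, ENNReal.toReal_ofReal (by positivity)]
        have h := hmem.2
        push_cast at h
        have e : (A : ℝ)⁻¹ * (truncVar (fun s => X s ω) 1 0 (A * t)).toReal - C * t =
            (A : ℝ)⁻¹ * ((truncVar (fun s => X s ω) 1 0 (A * t)).toReal - C * (A * t)) := by
          field_simp
        rw [e, abs_mul, abs_of_pos (by positivity)]
        calc _ < (A : ℝ)⁻¹ * (r / t * (A * t)) := by gcongr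
          _ = r := by field_simp
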